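/- Let $(\alpha_k)_{k\ge1}$, $(\beta_k)_{k\ge1}$, $(\delta_k)_{k\ge1}$ be sequences of random variables on a probability space, all of them (over all three sequences and all indices) mutually independent, where every $\alpha_k$, $\beta_k$, $\delta_k$ is exponentially distributed with parameter (rate) $\mu>0$, $\nu>0$, $\tau>0$ respectively. Consider the system $z(k)=A(k)z(k-1)$, $k\ge1$, in the semiring with the operations of maximum and addition, where $$A(k)=\begin{pmatrix}\alpha_k&\beta_k\\0&\delta_k\end{pmatrix},\qquad z(k)=\begin{pmatrix}x(k)\\y(k)\end{pmatrix},\qquad z(0)=\begin{pmatrix}0\\0\end{pmatrix};$$ that is, $x(0)=y(0)=0$ and, for $k\ge 1$, $$x(k)=\max(x(k-1)+\alpha_k,\;y(k-1)+\beta_k),\qquad y(k)=\max(x(k-1),\;y(k-1)+\delta_k).$$ (The lower left entry is the real number $0$.) Then in each of the following two cases the Lyapunov exponent $$\lambda=\lim_{k\to\infty}\frac1k\max(x(k),y(k))$$ exists almost surely and is the indicated constant. 1. If $\nu=\mu$, then $\lambda=P_1(\mu,\tau)/Q_1(\mu,\tau)$, where $$\begin{aligned}P_1(\mu,\tau)={}&288\mu^{8}+1048\mu^{7}\tau+1936\mu^{6}\tau^{2}+2688\mu^{5}\tau^{3}+3012\mu^{4}\tau^{4}\\&+2226\mu^{3}\tau^{5}+941\mu^{2}\tau^{6}+204\mu\tau^{7}+17\tau^{8},\\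 Q_1(\mu,\tau)={}&2\mu\tau(144\mu^{7}+524\mu^{6}\tau+968\mu^{5}\tau^{2}+1200\mu^{4}\tau^{3}+910\mu^{3}\tau^{4}\\&+387\mu^{2}\tau^{5}+84\mu\tau^{6}+7\tau^{7}).\end{aligned}$$ 2. If $\tau=\mu$, then $\lambda=P_2(\mu,\nu)/Q_2(\mu,\nu)$, where $$\begin{aligned}P_2(\mu,\nu)={}&256\mu^{10}+2112\mu^{9}\nu+8044\mu^{8}\nu^{2}+19355\mu^{7}\nu^{3}+32167\mu^{6}\nu^{4}+36887\mu^{5}\nu^{5}\\&+28709\mu^{4}\nu^{6}+14854\mu^{3}\nu^{7}+4912\mu^{2}\nu^{8}+944\mu\nu^{9}+80\nu^{10},\\ Q_2(\mu,\nu)={}&2\mu\nu(\mu+\nu)(192\mu^{8}+1344\mu^{7}\nu+4047\mu^{6}\nu^{2}+6770\mu^{5}\nu^{3}+6799\mu^{4}\nu^{4}\\&+4216\mu^{3}\nu^{5}+1600\mu^{2}\nu^{6}+344\mu\nu^{7}+32\nu^{8}).\end{aligned}$$ -/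

import Mathlib

open MeasureTheory ProbabilityTheory Filter Topology

/-- The state vector `z(k) = (x(k), y(k))` of the second-order max-plus linear system
`z(k) = A(k) z(k-1)`, `z(0) = (0, 0)`, that is
`x(k) = max (x(k-1) + A(k)₁₁) (y(k-1) + A(k)₁₂)`,
`y(k) = max (x(k-1) + A(k)₂₁) (y(k-1) + A(k)₂₂)`.
The entry `A k` of the sequence (indexed from `0`) is the transition matrix of step `k + 1`. -/
def maxPlusState (A : ℕ → Matrix (Fin 2) (Fin 2) ℝ) : ℕ → Fin 2 → ℝ
  | 0 => fun _ => 0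
  | k + 1 => fun i =>
      max (maxPlusState A k 0 + A k i 0) (maxPlusState A k 1 + A k i 1)

/-- The number `L` is the Lyapunov exponent of the system with random transition matrices `A`:
almost surely, `max (x(k)) (y(k)) / k` converges to `L`. -/
def IsLyapunovExponent {Ω : Type*} [MeasurableSpace Ω] (Pr : Measure Ω)
    (A : ℕ → Ω → Matrix (Fin 2) (Fin 2) ℝ) (L : ℝ) : Prop :=
  ∀ᵐ ω ∂Pr, Tendsto
    (fun k : ℕ => (1 / (k : ℝ)) *
      max (maxPlusState (fun j => A j ω) k 0) (maxPlusState (fun j => A j ω) k 1))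
    atTop (𝓝 L)

/-- Numerator in the case `ν = μ`. -/
def numEqNu (μ τ : ℝ) : ℝ :=
  288 * μ ^ 8 + 1048 * μ ^ 7 * τ + 1936 * μ ^ 6 * τ ^ 2 + 2688 * μ ^ 5 * τ ^ 3
    + 3012 * μ ^ 4 * τ ^ 4 + 2226 * μ ^ 3 * τ ^ 5 + 941 * μ ^ 2 * τ ^ 6
    + 204 * μ * τ ^ 7 + 17 * τ ^ 8

/-- Denominator in the case `ν = μ`. -/
def denEqNu (μ τ : ℝ) : ℝ :=
  2 * μ * τ *
    (144 * μ ^ 7 + 524 * μ ^ 6 * τ + 968 * μ ^ 5 * τ ^ 2 + 1200 * μ ^ 4 * τ ^ 3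
      + 910 * μ ^ 3 * τ ^ 4 + 387 * μ ^ 2 * τ ^ 5 + 84 * μ * τ ^ 6 + 7 * τ ^ 7)

/-- Numerator in the case `τ = μ`. -/
def numEqTau (μ ν : ℝ) : ℝ :=
  256 * μ ^ 10 + 2112 * μ ^ 9 * ν + 8044 * μ ^ 8 * ν ^ 2 + 19355 * μ ^ 7 * ν ^ 3
    + 32167 * μ ^ 6 * ν ^ 4 + 36887 * μ ^ 5 * ν ^ 5 + 28709 * μ ^ 4 * ν ^ 6
    + 14854 * μ ^ 3 * ν ^ 7 + 4912 * μ ^ 2 * ν ^ 8 + 944 * μ * ν ^ 9 + 80 * ν ^ 10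

/-- Denominator in the case `τ = μ`. -/
def denEqTau (μ ν : ℝ) : ℝ :=
  2 * μ * ν * (μ + ν) *
    (192 * μ ^ 8 + 1344 * μ ^ 7 * ν + 4047 * μ ^ 6 * ν ^ 2 + 6770 * μ ^ 5 * ν ^ 3
      + 6799 * μ ^ 4 * ν ^ 4 + 4216 * μ ^ 3 * ν ^ 5 + 1600 * μ ^ 2 * ν ^ 6
      + 344 * μ * ν ^ 7 + 32 * ν ^ 8)

/-! ### Integrals against exponential distributions -/

/-! The differences `d = y - x` form a Markov chain: subtracting `x` from both coordinates, the next
state is `(max a (b + d), max 0 (c + d))` with fresh noise `a`, `b`, `c`. The plan is to find a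
bounded function `h` (the `corrector`) and a constant `L` solving the Poisson equation, which says
that `max x y + h (y - x)` grows by exactly `L` in mean at each step, from every state.

The equation is finite dimensional because exponentials are memoryless. If `d < 0`, then `b` exceeds
`-d` with probability `exp (ν d)`, and `c` does with probability `exp (τ d)`; each overshoot is
again exponential. Relative to `x`, the law of the next state is thus a mixture of the laws of `(a,
0)`, `(max a b, 0)`, `(a, c)`, `(max a b, c)`. If `d ≥ 0`, then relative to `x + d` it is a mixture
of the laws of `(max a b, c)` and `(b, c)`, with weights `exp (-μ d)` and `1 - exp (-μ d)`. Let `h`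
have these same weights and values `f 0, ..., f 4` at the five laws, in this order. The equation
then reduces to five linear equations in `f` and `L` (`IsPoissonSolution`,
`integral_correctedMax_step`). This holds for all positive rates; the equalities `ν = μ` and `τ = μ`
serve only to give explicit solutions.

Given a solution, the recentred increments are martingale differences with uniformly bounded second
moments. Orthogonality and a second-moment bound give almost sure convergence of their averages
along the squares `n ^ 2`. Their sums telescope to `max x y - n * L` up to a bounded term, and
monotonicity of `max x y` extends the limit to all times
(`isLyapunovExponent_of_isPoissonSolution`). -/

lemma expMeasure_Iic {r : ℝ} (hr : 0 < r) (x : ℝ) :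
    expMeasure r (Set.Iic x) = ENNReal.ofReal (if 0 ≤ x then 1 - Real.exp (-(r * x)) else 0) := by
  rw [← lintegral_exponentialPDF_eq_antiDeriv hr x, expMeasure, gammaMeasure,
    withDensity_apply _ measurableSet_Iic]
  rfl

lemma one_sub_exp_neg_mul_nonneg {r x : ℝ} (hr : 0 < r) (hx : 0 ≤ x) :
    0 ≤ 1 - Real.exp (-(r * x)) :=
  sub_nonneg.2 (Real.exp_le_one_iff.2 (neg_nonpos.2 (mul_nonneg hr.le hx)))

lemma expMeasure_ae_pos {r : ℝ} (hr : 0 < r) : ∀ᵐ x ∂expMeasure r, 0 < x := by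
  rw [ae_iff]
  have h : {x : ℝ | ¬ 0 < x} = Set.Iic 0 := by ext x; simp
  rw [h, expMeasure_Iic hr]
  simp

lemma expMeasure_eq_withDensity (r : ℝ) :
    expMeasure r = (volume.restrict (Set.Ioi 0)).withDensity
      (fun x => ENNReal.ofReal (r * Real.exp (-(r * x)))) := by
  have h : expMeasure r = volume.withDensity ((Set.Ici (0 : ℝ)).indicator
      (fun x => ENNReal.ofReal (r * Real.exp (-(r * x))))) := by
    change volume.withDensity (exponentialPDF r) = _
    congr 1
    ext x
    rw [exponentialPDF_eq]
    by_cases hx : 0 ≤ x <;> simp [hx]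
  rw [h, withDensity_indicator measurableSet_Ici, restrict_Ioi_eq_restrict_Ici]

lemma integral_expMeasure {r : ℝ} (hr : 0 < r) (g : ℝ → ℝ) :
    ∫ x, g x ∂expMeasure r = ∫ x in Set.Ioi 0, r * Real.exp (-(r * x)) * g x := by
  rw [expMeasure_eq_withDensity r, integral_withDensity_eq_integral_toReal_smul (by fun_prop)
    (by simp)]
  refine integral_congr_ae (Eventually.of_forall fun x => ?_)
  simp only [smul_eq_mul]
  rw [ENNReal.toReal_ofReal (by positivity)]

lemma integrable_expMeasure_iff {r : ℝ} (hr : 0 < r) (g : ℝ → ℝ) :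
    Integrable g (expMeasure r) ↔
      IntegrableOn (fun x => r * Real.exp (-(r * x)) * g x) (Set.Ioi 0) := by
  rw [expMeasure_eq_withDensity r, integrable_withDensity_iff_integrable_smul' (by fun_prop)
    (by simp)]
  refine integrable_congr (Eventually.of_forall fun x => ?_)
  simp only [smul_eq_mul]
  rw [ENNReal.toReal_ofReal (by positivity)]

lemma integral_exp_neg_mul_expMeasure {r s : ℝ} (hr : 0 < r) (hs : 0 ≤ s) :
    ∫ x, Real.exp (-(s * x)) ∂expMeasure r = r / (r + s) := by
  rw [integral_expMeasure hr]
  have h : ∀ x : ℝ, r * Real.exp (-(r * x)) * Real.exp (-(s * x))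
      = r * Real.exp (-(r + s) * x) := fun x => by
    rw [mul_assoc, ← Real.exp_add]; ring_nf
  simp_rw [h]
  rw [integral_const_mul, integral_exp_mul_Ioi (by linarith)]
  have : r + s ≠ 0 := by positivity
  rw [mul_zero, Real.exp_zero]
  field_simp

lemma integrable_exp_neg_mul_expMeasure {r s : ℝ} (hr : 0 < r) (hs : 0 ≤ s) :
    Integrable (fun x => Real.exp (-(s * x))) (expMeasure r) := by
  have := isProbabilityMeasure_expMeasure hr
  refine Integrable.of_bound (by fun_prop) 1 ?_
  filter_upwards [expMeasure_ae_pos hr] with x hx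
  simp; positivity

lemma integrable_pow_expMeasure {r : ℝ} (hr : 0 < r) (n : ℕ) :
    Integrable (fun x => x ^ n) (expMeasure r) := by
  rw [integrable_expMeasure_iff hr]
  have h := (integrableOn_rpow_mul_exp_neg_mul_rpow (s := n) (p := 1) (b := r)
    (by linarith [n.cast_nonneg (α := ℝ)]) one_pos hr).const_mul r
  refine h.congr (Eventually.of_forall fun x => ?_)
  simp only [Real.rpow_one, Real.rpow_natCast]
  ring_nf

lemma integral_id_expMeasure {r : ℝ} (hr : 0 < r) : ∫ x, x ∂expMeasure r = 1 / r := by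
  rw [integral_expMeasure hr]
  have h := Real.integral_rpow_mul_exp_neg_mul_Ioi (a := 2) (r := r) two_pos hr
  have h2 : ∀ x : ℝ, r * Real.exp (-(r * x)) * x
      = r * (x ^ ((2 : ℝ) - 1) * Real.exp (-(r * x))) := fun x => by
    have : (2 : ℝ) - 1 = 1 := by norm_num
    rw [this, Real.rpow_one]; ring
  simp_rw [h2]
  rw [integral_const_mul, h, Real.Gamma_two]
  rw [Real.rpow_two]
  field_simp

/-! ### Linear growth, and the laws of overshoots, maxima and differences -/

/-- Measurable functions of at most linear growth. -/
def LinearGrowth (g : ℝ → ℝ) : Prop :=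
  Measurable g ∧ ∃ C, ∀ x, |g x| ≤ C * (1 + |x|)

/-- Measurable functions of two variables of at most linear growth. -/
def LinearGrowthTwo (g : ℝ → ℝ → ℝ) : Prop :=
  Measurable (Function.uncurry g) ∧ ∃ C, ∀ x y, |g x y| ≤ C * (1 + |x| + |y|)

lemma LinearGrowth.integrable {g : ℝ → ℝ} (hg : LinearGrowth g) {r : ℝ} (hr : 0 < r) :
    Integrable g (expMeasure r) := by
  have := isProbabilityMeasure_expMeasure hr
  obtain ⟨hm, C, hC⟩ := hg
  have h1 : Integrable (fun x : ℝ => C * (1 + |x|)) (expMeasure r) := by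
    have := (integrable_pow_expMeasure hr 1).abs
    simp only [pow_one] at this
    exact ((integrable_const 1).add this).const_mul C
  exact h1.mono' hm.aestronglyMeasurable (Eventually.of_forall hC)

lemma LinearGrowthTwo.integrable {g : ℝ → ℝ → ℝ} (hg : LinearGrowthTwo g) {r s : ℝ}
    (hr : 0 < r) (hs : 0 < s) :
    Integrable (fun p : ℝ × ℝ => g p.1 p.2) ((expMeasure r).prod (expMeasure s)) := by
  have := isProbabilityMeasure_expMeasure hr
  have := isProbabilityMeasure_expMeasure hs
  obtain ⟨hm, C, hC⟩ := hg
  have h1 := (integrable_pow_expMeasure hr 1).abs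
  have h2 := (integrable_pow_expMeasure hs 1).abs
  simp only [pow_one] at h1 h2
  have h3 : Integrable (fun p : ℝ × ℝ => C * (1 + |p.1| + |p.2|))
      ((expMeasure r).prod (expMeasure s)) :=
    (((integrable_const 1).add (h1.comp_fst _)).add (h2.comp_snd _)).const_mul C
  exact h3.mono' hm.aestronglyMeasurable (Eventually.of_forall fun p => hC p.1 p.2)

/-- Memorylessness: the law of the overshoot of an exponential variable above the level `e`. -/
lemma expMeasure_map_overshoot {r e : ℝ} (hr : 0 < r) (he : 0 ≤ e) :
    (expMeasure r).map (fun x => max (x - e) 0) =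
      ENNReal.ofReal (1 - Real.exp (-(r * e))) • Measure.dirac 0 +
        ENNReal.ofReal (Real.exp (-(r * e))) • expMeasure r := by
  have := isProbabilityMeasure_expMeasure hr
  have hm : Measurable fun x : ℝ => max (x - e) 0 := by fun_prop
  have := Measure.isProbabilityMeasure_map (μ := expMeasure r) hm.aemeasurable
  refine Measure.ext_of_Iic _ _ fun a => ?_
  rw [Measure.map_apply hm measurableSet_Iic]
  simp only [Measure.add_apply, Measure.smul_apply, smul_eq_mul, expMeasure_Iic hr]
  rcases lt_or_ge a 0 with ha | ha
  · have h : (fun x : ℝ => max (x - e) 0) ⁻¹' Set.Iic a = ∅ := by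
      ext x; simp [ha]
    rw [h]
    simp [ha.not_ge]
  · have h : (fun x : ℝ => max (x - e) 0) ⁻¹' Set.Iic a = Set.Iic (a + e) := by
      ext x; simp [ha]
    rw [h, expMeasure_Iic hr, if_pos (by positivity), if_pos ha, Measure.dirac_apply' _ measurableSet_Iic,
      Set.indicator_of_mem (by simpa using ha), Pi.one_apply, mul_one,
      ← ENNReal.ofReal_mul (Real.exp_pos _).le, ← ENNReal.ofReal_add
        (one_sub_exp_neg_mul_nonneg hr he)
        (mul_nonneg (Real.exp_pos _).le (one_sub_exp_neg_mul_nonneg hr ha))]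
    congr 1
    rw [mul_sub, ← Real.exp_add]
    ring_nf

lemma integral_overshoot {r e : ℝ} (hr : 0 < r) (he : 0 ≤ e) {g : ℝ → ℝ} (hg : LinearGrowth g) :
    ∫ x, g (max (x - e) 0) ∂expMeasure r =
      (1 - Real.exp (-(r * e))) * g 0 + Real.exp (-(r * e)) * ∫ x, g x ∂expMeasure r := by
  have hm : Measurable fun x : ℝ => max (x - e) 0 := by fun_prop
  rw [← integral_map hm.aemeasurable (f := g) hg.1.aestronglyMeasurable,
    expMeasure_map_overshoot hr he, integral_add_measure, integral_smul_measure,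
    integral_smul_measure, integral_dirac, ENNReal.toReal_ofReal (one_sub_exp_neg_mul_nonneg hr he),
    ENNReal.toReal_ofReal (Real.exp_pos _).le, smul_eq_mul, smul_eq_mul]
  · exact (integrable_dirac (by simp)).smul_measure ENNReal.ofReal_ne_top
  · exact (hg.integrable hr).smul_measure ENNReal.ofReal_ne_top

/-- Inclusion-exclusion for the maximum of two independent exponential variables. -/
lemma expMeasure_map_max {r s : ℝ} (hr : 0 < r) (hs : 0 < s) :
    ((expMeasure r).prod (expMeasure s)).map (fun p => max p.1 p.2) + expMeasure (r + s) =
      expMeasure r + expMeasure s := by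
  have hrs : 0 < r + s := by positivity
  have := isProbabilityMeasure_expMeasure hr
  have := isProbabilityMeasure_expMeasure hs
  have := isProbabilityMeasure_expMeasure hrs
  have hm : Measurable fun p : ℝ × ℝ => max p.1 p.2 := by fun_prop
  have := Measure.isProbabilityMeasure_map (μ := (expMeasure r).prod (expMeasure s))
    hm.aemeasurable
  refine Measure.ext_of_Iic _ _ fun a => ?_
  have h : (fun p : ℝ × ℝ => max p.1 p.2) ⁻¹' Set.Iic a = Set.Iic a ×ˢ Set.Iic a := by
    ext x; simp [-Set.Iic_prod_Iic]
  rw [Measure.add_apply, Measure.add_apply, Measure.map_apply hm measurableSet_Iic, h,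
    Measure.prod_prod]
  simp only [expMeasure_Iic hr, expMeasure_Iic hs, expMeasure_Iic hrs]
  split_ifs with ha
  · have h1 := one_sub_exp_neg_mul_nonneg hr ha
    have h2 := one_sub_exp_neg_mul_nonneg hs ha
    have h3 := one_sub_exp_neg_mul_nonneg hrs ha
    -- With `u`, `v` the two tails at `a`, the claim is `(1 - u) * (1 - v) + (1 - u * v) = (1 - u) +
    -- (1 - v)`, where `u * v` is the tail of rate `r + s`.
    rw [← ENNReal.ofReal_mul h1, ← ENNReal.ofReal_add (mul_nonneg h1 h2) h3,
      ← ENNReal.ofReal_add h1 h2]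
    congr 1
    rw [show -((r + s) * a) = -(r * a) + -(s * a) by ring, Real.exp_add]
    ring
  · simp

lemma LinearGrowth.comp_max {g : ℝ → ℝ} (hg : LinearGrowth g) :
    LinearGrowthTwo fun x y => g (max x y) := by
  obtain ⟨hm, C, hC⟩ := hg
  have hC0 : 0 ≤ C := by simpa using (abs_nonneg _).trans (hC 0)
  refine ⟨hm.comp (by fun_prop), C, fun x y => (hC _).trans ?_⟩
  have : |max x y| ≤ |x| + |y| := by
    rcases max_choice x y with h | h <;> rw [h] <;> linarith [abs_nonneg x, abs_nonneg y]
  rw [add_assoc]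
  gcongr

lemma integral_max_expMeasure {r s : ℝ} (hr : 0 < r) (hs : 0 < s) {g : ℝ → ℝ}
    (hg : LinearGrowth g) :
    ∫ x, ∫ y, g (max x y) ∂expMeasure s ∂expMeasure r =
      ∫ x, g x ∂expMeasure r + ∫ x, g x ∂expMeasure s - ∫ x, g x ∂expMeasure (r + s) := by
  have := isProbabilityMeasure_expMeasure hr
  have := isProbabilityMeasure_expMeasure hs
  have hm : Measurable fun p : ℝ × ℝ => max p.1 p.2 := by fun_prop
  have hi := hg.comp_max.integrable hr hs
  have h := congrArg (fun m => ∫ x, g x ∂m) (expMeasure_map_max hr hs)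
  rw [integral_add_measure ((integrable_map_measure hg.1.aestronglyMeasurable hm.aemeasurable).2 hi)
    (hg.integrable (by positivity)), integral_add_measure (hg.integrable hr) (hg.integrable hs),
    integral_map hm.aemeasurable hg.1.aestronglyMeasurable, integral_prod _ hi] at h
  linarith

lemma LinearGrowth.comp {g h : ℝ → ℝ} (hg : LinearGrowth g) (hh : LinearGrowth h) :
    LinearGrowth fun x => g (h x) := by
  obtain ⟨hm, C, hC⟩ := hg
  obtain ⟨hm', C', hC'⟩ := hh
  have hC0 : 0 ≤ C := by simpa using (abs_nonneg _).trans (hC 0)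
  refine ⟨hm.comp hm', C * (1 + C'), fun x => (hC _).trans ?_⟩
  have := hC' x
  rw [mul_assoc]
  gcongr
  nlinarith [abs_nonneg x]

lemma LinearGrowth.comp₂ {g : ℝ → ℝ} {h : ℝ → ℝ → ℝ} (hg : LinearGrowth g)
    (hh : LinearGrowthTwo h) : LinearGrowthTwo fun x y => g (h x y) := by
  obtain ⟨hm, C, hC⟩ := hg
  obtain ⟨hm', C', hC'⟩ := hh
  have hC0 : 0 ≤ C := by simpa using (abs_nonneg _).trans (hC 0)
  refine ⟨hm.comp hm', C * (1 + C'), fun x y => (hC _).trans ?_⟩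
  rw [mul_assoc]
  gcongr
  nlinarith [hC' x y, abs_nonneg x, abs_nonneg y]

lemma LinearGrowthTwo.left {g : ℝ → ℝ → ℝ} (hg : LinearGrowthTwo g) (y : ℝ) :
    LinearGrowth fun x => g x y := by
  obtain ⟨hm, C, hC⟩ := hg
  have hC0 : 0 ≤ C := by simpa using (abs_nonneg _).trans (hC 0 0)
  refine ⟨hm.comp (by fun_prop : Measurable fun x => (x, y)), C * (1 + |y|),
    fun x => (hC _ _).trans ?_⟩
  rw [mul_assoc]
  gcongr
  nlinarith [abs_nonneg x, abs_nonneg y]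

lemma LinearGrowthTwo.right {g : ℝ → ℝ → ℝ} (hg : LinearGrowthTwo g) (x : ℝ) :
    LinearGrowth fun y => g x y := by
  obtain ⟨hm, C, hC⟩ := hg
  have hC0 : 0 ≤ C := by simpa using (abs_nonneg _).trans (hC 0 0)
  refine ⟨hm.comp (by fun_prop : Measurable fun y => (x, y)), C * (1 + |x|),
    fun y => (hC _ _).trans ?_⟩
  rw [mul_assoc]
  gcongr
  nlinarith [abs_nonneg x, abs_nonneg y]

lemma LinearGrowthTwo.integral {g : ℝ → ℝ → ℝ} (hg : LinearGrowthTwo g) {r : ℝ} (hr : 0 < r) :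
    LinearGrowth fun x => ∫ y, g x y ∂expMeasure r := by
  have := isProbabilityMeasure_expMeasure hr
  have hi := fun x => (hg.right x).integrable hr
  obtain ⟨hm, C, hC⟩ := hg
  have hC0 : 0 ≤ C := by simpa using (abs_nonneg _).trans (hC 0 0)
  refine ⟨hm.stronglyMeasurable.integral_prod_right.measurable,
    C * (1 + ∫ y, |y| ∂expMeasure r), fun x => ?_⟩
  have hy := (integrable_pow_expMeasure hr 1).abs
  simp only [pow_one] at hy
  have h0 : 0 ≤ ∫ y, |y| ∂expMeasure r := integral_nonneg fun y => abs_nonneg y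
  calc |∫ y, g x y ∂expMeasure r| ≤ ∫ y, |g x y| ∂expMeasure r := abs_integral_le_integral_abs
    _ ≤ ∫ y, C * (1 + |x| + |y|) ∂expMeasure r :=
        integral_mono (hi x).abs (((integrable_const _).add hy).const_mul C) (hC x)
    _ = C * (1 + |x| + ∫ y, |y| ∂expMeasure r) := by
        rw [integral_const_mul, integral_add (integrable_const _) hy]; simp
    _ ≤ _ := by rw [mul_assoc]; gcongr; nlinarith [abs_nonneg x]

lemma LinearGrowth.add {g h : ℝ → ℝ} (hg : LinearGrowth g) (hh : LinearGrowth h) :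
    LinearGrowth fun x => g x + h x := by
  obtain ⟨hm, C, hC⟩ := hg
  obtain ⟨hm', C', hC'⟩ := hh
  exact ⟨hm.add hm', C + C', fun x => (abs_add_le _ _).trans
    (by linarith [hC x, hC' x])⟩

lemma LinearGrowth.const_mul {g : ℝ → ℝ} (hg : LinearGrowth g) (c : ℝ) :
    LinearGrowth fun x => c * g x := by
  obtain ⟨hm, C, hC⟩ := hg
  refine ⟨hm.const_mul c, |c| * C, fun x => ?_⟩
  rw [abs_mul, mul_assoc]
  gcongr
  exact hC x

/-- By memorylessness the overshoot is zero with probability `1 - exp (-(s * e))`, leaving `x`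
alone, and otherwise a fresh exponential, to which inclusion-exclusion for the maximum applies. -/
lemma integral_max_overshoot {r s e : ℝ} (hr : 0 < r) (hs : 0 < s) (he : 0 ≤ e) {g : ℝ → ℝ}
    (hg : LinearGrowth g) :
    ∫ x, ∫ y, g (max x (max (y - e) 0)) ∂expMeasure s ∂expMeasure r =
      (1 - Real.exp (-(s * e))) * ∫ x, g x ∂expMeasure r + Real.exp (-(s * e)) *
        (∫ x, g x ∂expMeasure r + ∫ x, g x ∂expMeasure s - ∫ x, g x ∂expMeasure (r + s)) := by
  rw [← integral_max_expMeasure hr hs hg]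
  have h : ∀ᵐ x ∂expMeasure r, ∫ y, g (max x (max (y - e) 0)) ∂expMeasure s =
      (1 - Real.exp (-(s * e))) * g x +
        Real.exp (-(s * e)) * ∫ y, g (max x y) ∂expMeasure s := by
    filter_upwards [expMeasure_ae_pos hr] with x hx
    rw [integral_overshoot hs he (g := fun y => g (max x y)) (hg.comp_max.right x),
      max_eq_left hx.le]
  rw [integral_congr_ae h, integral_add ((hg.integrable hr).const_mul _)
    (((hg.comp_max.integral hs).integrable hr).const_mul _), integral_const_mul,
    integral_const_mul]

/-- The difference of two independent exponential variables. -/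
lemma integral_sub_expMeasure {r t : ℝ} (hr : 0 < r) (ht : 0 < t) {g : ℝ → ℝ}
    (hg : LinearGrowth g) :
    ∫ x, ∫ y, g (y - x) ∂expMeasure t ∂expMeasure r =
      r / (r + t) * ∫ y, g y ∂expMeasure t + t / (r + t) * ∫ x, g (-x) ∂expMeasure r := by
  have := isProbabilityMeasure_expMeasure hr
  have := isProbabilityMeasure_expMeasure ht
  have hneg : LinearGrowth fun x => g (-x) :=
    hg.comp (h := fun x => -x) ⟨measurable_neg, 1, fun x => by simp⟩
  have hmax : LinearGrowthTwo fun x y => max (y - x) 0 := by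
    refine ⟨by unfold Function.uncurry; fun_prop, 1, fun x y => ?_⟩
    rw [abs_of_nonneg (le_max_right _ _)]
    refine max_le ?_ (by positivity)
    linarith [neg_abs_le x, le_abs_self y]
  have hmax' : LinearGrowthTwo fun x y => max (x - y) 0 := by
    refine ⟨by unfold Function.uncurry; fun_prop, 1, fun x y => ?_⟩
    rw [abs_of_nonneg (le_max_right _ _)]
    refine max_le ?_ (by positivity)
    linarith [le_abs_self x, neg_abs_le y]
  have i1 := (hg.comp₂ hmax)
  have i2 := (hneg.comp₂ hmax')
  -- One of the two positive parts always vanishes and contributes `g 0`. Each of the others is an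
  -- overshoot above an independent exponential level.
  have h : ∀ x y : ℝ, g (y - x) = g (max (y - x) 0) + g (-max (x - y) 0) - g 0 := fun x y => by
    rcases le_total x y with h | h
    · rw [max_eq_left (by linarith), max_eq_right (by linarith)]; simp
    · rw [max_eq_right (by linarith), max_eq_left (by linarith)]; simp
  have e1 : ∫ x, ∫ y, g (max (y - x) 0) ∂expMeasure t ∂expMeasure r =
      t / (r + t) * g 0 + r / (r + t) * ∫ y, g y ∂expMeasure t := by
    have h : ∀ᵐ x ∂expMeasure r, ∫ y, g (max (y - x) 0) ∂expMeasure t = g 0 +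
        Real.exp (-(t * x)) * (∫ y, g y ∂expMeasure t - g 0) := by
      filter_upwards [expMeasure_ae_pos hr] with x hx
      rw [integral_overshoot ht hx.le hg]; ring
    have hi := integrable_exp_neg_mul_expMeasure hr ht.le
    rw [integral_congr_ae h, integral_add (integrable_const _) (hi.mul_const _),
      integral_mul_const, integral_exp_neg_mul_expMeasure hr ht.le]
    simp
    field_simp
    ring
  have e2 : ∫ x, ∫ y, g (-max (x - y) 0) ∂expMeasure t ∂expMeasure r =
      r / (r + t) * g 0 + t / (r + t) * ∫ x, g (-x) ∂expMeasure r := by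
    -- Here `x` overshoots the level `y`, so `x` has to be integrated first.
    rw [integral_integral_swap (f := fun x y => g (-max (x - y) 0)) (i2.integrable hr ht)]
    have h : ∀ᵐ y ∂expMeasure t, ∫ x, g (-max (x - y) 0) ∂expMeasure r = g 0 +
        Real.exp (-(r * y)) * (∫ x, g (-x) ∂expMeasure r - g 0) := by
      filter_upwards [expMeasure_ae_pos ht] with x hx
      rw [integral_overshoot hr hx.le hneg]; simp; ring
    have hi := integrable_exp_neg_mul_expMeasure ht hr.le
    rw [integral_congr_ae h, integral_add (integrable_const _) (hi.mul_const _),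
      integral_mul_const, integral_exp_neg_mul_expMeasure ht hr.le]
    simp
    field_simp
    ring
  simp_rw [h]
  have e3 : ∀ x, ∫ y, (g (max (y - x) 0) + g (-max (x - y) 0) - g 0) ∂expMeasure t =
      ∫ y, g (max (y - x) 0) ∂expMeasure t + ∫ y, g (-max (x - y) 0) ∂expMeasure t - g 0 := by
    intro x
    have j1 := (i1.right x).integrable ht
    have j2 := (i2.right x).integrable ht
    rw [integral_sub (by exact j1.add j2) (integrable_const _), integral_add j1 j2]
    simp
  simp_rw [e3]
  have j1 := (i1.integral ht).integrable hr
  have j2 := (i2.integral ht).integrable hr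
  rw [integral_sub (by exact j1.add j2) (integrable_const _), integral_add j1 j2, e1, e2]
  simp
  field_simp
  ring

/-! ### The corrector and the Poisson equation -/

/-- The bounded corrector of the chain `y - x`, a mixture of five values. -/
noncomputable def corrector (μ ν τ : ℝ) (f : Fin 5 → ℝ) (d : ℝ) : ℝ :=
  if d < 0 then
    f 0 * ((1 - Real.exp (τ * d)) * (1 - Real.exp (ν * d)))
      + f 1 * ((1 - Real.exp (τ * d)) * Real.exp (ν * d))
      + f 2 * (Real.exp (τ * d) * (1 - Real.exp (ν * d)))
      + f 3 * (Real.exp (τ * d) * Real.exp (ν * d))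
  else f 3 * Real.exp (-(μ * d)) + f 4 * (1 - Real.exp (-(μ * d)))

/-- The mean of the corrector at minus an exponential variable of rate `r`. -/
noncomputable def correctorNegMean (ν τ : ℝ) (f : Fin 5 → ℝ) (r : ℝ) : ℝ :=
  f 0 * (1 - r / (r + τ) - r / (r + ν) + r / (r + (τ + ν)))
    + f 1 * (r / (r + ν) - r / (r + (τ + ν)))
    + f 2 * (r / (r + τ) - r / (r + (τ + ν))) + f 3 * (r / (r + (τ + ν)))

/-- The mean of `max x 0` plus the corrector at `-x`, for `x` exponential of rate `r`. -/
noncomputable def meanAtZero (ν τ : ℝ) (f : Fin 5 → ℝ) (r : ℝ) : ℝ :=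
  1 / r + correctorNegMean ν τ f r

/-- The mean of `max x y` plus the corrector at `y - x`, for independent exponential `x`, `y` of
rates `r`, `τ`. -/
noncomputable def meanAtExp (μ ν τ : ℝ) (f : Fin 5 → ℝ) (r : ℝ) : ℝ :=
  1 / r + 1 / τ - 1 / (r + τ)
    + (r / (r + τ) * (f 3 * (τ / (τ + μ)) + f 4 * (1 - τ / (τ + μ)))
      + τ / (r + τ) * correctorNegMean ν τ f r)

/-- The finite linear system which encodes the Poisson equation with drift `L`. -/
def IsPoissonSolution (μ ν τ : ℝ) (f : Fin 5 → ℝ) (L : ℝ) : Prop :=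
  f 0 + L = meanAtZero ν τ f μ ∧
  f 1 + L = meanAtZero ν τ f μ + meanAtZero ν τ f ν - meanAtZero ν τ f (μ + ν) ∧
  f 2 + L = meanAtExp μ ν τ f μ ∧
  f 3 + L = meanAtExp μ ν τ f μ + meanAtExp μ ν τ f ν - meanAtExp μ ν τ f (μ + ν) ∧
  f 4 + L = meanAtExp μ ν τ f ν

lemma measurable_corrector (μ ν τ : ℝ) (f : Fin 5 → ℝ) : Measurable (corrector μ ν τ f) := by
  unfold corrector
  exact Measurable.ite measurableSet_Iio (by fun_prop) (by fun_prop)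

lemma abs_mul_le_of_mem_Icc {a w : ℝ} (h0 : 0 ≤ w) (h1 : w ≤ 1) : |a * w| ≤ |a| := by
  rw [abs_mul, abs_of_nonneg h0]
  exact mul_le_of_le_one_right (abs_nonneg a) h1

/-- At each `d` the coefficients of the `f i` are probabilities, hence lie in `[0, 1]`. The bound is
uniform in `d`, so the corrector disappears after division by time. -/
lemma abs_corrector_le {μ ν τ : ℝ} (hμ : 0 < μ) (hν : 0 < ν) (hτ : 0 < τ) (f : Fin 5 → ℝ)
    (d : ℝ) : |corrector μ ν τ f d| ≤ |f 0| + |f 1| + |f 2| + |f 3| + |f 4| := by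
  unfold corrector
  split_ifs with h
  · have a0 := Real.exp_pos (τ * d)
    have a1 : Real.exp (τ * d) ≤ 1 := Real.exp_le_one_iff.2 (by nlinarith)
    have b0 := Real.exp_pos (ν * d)
    have b1 : Real.exp (ν * d) ≤ 1 := Real.exp_le_one_iff.2 (by nlinarith)
    generalize Real.exp (τ * d) = a at *
    generalize Real.exp (ν * d) = b at *
    have h0 := abs_mul_le_of_mem_Icc (a := f 0) (w := (1 - a) * (1 - b))
      (mul_nonneg (by linarith) (by linarith)) (mul_le_one₀ (by linarith) (by linarith) (by linarith))
    have h1 := abs_mul_le_of_mem_Icc (a := f 1) (w := (1 - a) * b)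
      (mul_nonneg (by linarith) (by linarith)) (mul_le_one₀ (by linarith) (by linarith) (by linarith))
    have h2 := abs_mul_le_of_mem_Icc (a := f 2) (w := a * (1 - b))
      (mul_nonneg (by linarith) (by linarith)) (mul_le_one₀ (by linarith) (by linarith) (by linarith))
    have h3 := abs_mul_le_of_mem_Icc (a := f 3) (w := a * b)
      (mul_nonneg (by linarith) (by linarith)) (mul_le_one₀ (by linarith) (by linarith) (by linarith))
    refine (abs_add_le _ _).trans ?_
    refine (add_le_add_left (abs_add_le _ _) _).trans ?_
    refine (add_le_add_left (add_le_add_left (abs_add_le _ _) _) _).trans ?_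
    linarith [abs_nonneg (f 4)]
  · have a0 := Real.exp_pos (-(μ * d))
    have a1 : Real.exp (-(μ * d)) ≤ 1 := Real.exp_le_one_iff.2 (by nlinarith)
    generalize Real.exp (-(μ * d)) = a at *
    have h0 := abs_mul_le_of_mem_Icc (a := f 3) a0.le a1
    have h1 := abs_mul_le_of_mem_Icc (a := f 4) (w := 1 - a) (by linarith) (by linarith)
    refine (abs_add_le _ _).trans ?_
    linarith [abs_nonneg (f 0), abs_nonneg (f 1), abs_nonneg (f 2)]

lemma linearGrowth_corrector {μ ν τ : ℝ} (hμ : 0 < μ) (hν : 0 < ν) (hτ : 0 < τ)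
    (f : Fin 5 → ℝ) : LinearGrowth (corrector μ ν τ f) := by
  refine ⟨measurable_corrector μ ν τ f, |f 0| + |f 1| + |f 2| + |f 3| + |f 4|, fun x => ?_⟩
  refine (abs_corrector_le hμ hν hτ f x).trans (le_mul_of_one_le_right (by positivity) ?_)
  linarith [abs_nonneg x]

lemma integral_corrector {μ ν τ : ℝ} (hμ : 0 < μ) (hτ : 0 < τ) (f : Fin 5 → ℝ) :
    ∫ x, corrector μ ν τ f x ∂expMeasure τ =
      f 3 * (τ / (τ + μ)) + f 4 * (1 - τ / (τ + μ)) := by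
  have := isProbabilityMeasure_expMeasure hτ
  have h : ∀ᵐ x ∂expMeasure τ, corrector μ ν τ f x =
      f 4 + (f 3 - f 4) * Real.exp (-(μ * x)) := by
    filter_upwards [expMeasure_ae_pos hτ] with x hx
    rw [corrector, if_neg hx.not_gt]; ring
  have hi := integrable_exp_neg_mul_expMeasure hτ hμ.le
  rw [integral_congr_ae h, integral_add (integrable_const _) (hi.const_mul _), integral_const_mul,
    integral_exp_neg_mul_expMeasure hτ hμ.le]
  simp
  ring

lemma integral_corrector_neg {μ ν τ r : ℝ} (hν : 0 < ν) (hτ : 0 < τ) (hr : 0 < r)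
    (f : Fin 5 → ℝ) :
    ∫ x, corrector μ ν τ f (-x) ∂expMeasure r = correctorNegMean ν τ f r := by
  have := isProbabilityMeasure_expMeasure hr
  have h : ∀ᵐ x ∂expMeasure r, corrector μ ν τ f (-x) =
      f 0 + (f 2 - f 0) * Real.exp (-(τ * x)) + (f 1 - f 0) * Real.exp (-(ν * x))
        + (f 0 - f 1 - f 2 + f 3) * Real.exp (-((τ + ν) * x)) := by
    filter_upwards [expMeasure_ae_pos hr] with x hx
    rw [corrector, if_pos (by linarith), show -((τ + ν) * x) = τ * -x + ν * -x by ring,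
      Real.exp_add, mul_neg, mul_neg]
    ring
  have i1 := (integrable_exp_neg_mul_expMeasure hr hτ.le).const_mul (f 2 - f 0)
  have i2 := (integrable_exp_neg_mul_expMeasure hr hν.le).const_mul (f 1 - f 0)
  have i3 := (integrable_exp_neg_mul_expMeasure hr (add_pos hτ hν).le).const_mul
    (f 0 - f 1 - f 2 + f 3)
  have i0 := integrable_const (μ := expMeasure r) (f 0)
  rw [integral_congr_ae h, integral_add (by exact (i0.add i1).add i2) i3,
    integral_add (by exact i0.add i1) i2,
    integral_add i0 i1, integral_const_mul, integral_const_mul, integral_const_mul,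
    integral_exp_neg_mul_expMeasure hr hτ.le, integral_exp_neg_mul_expMeasure hr hν.le,
    integral_exp_neg_mul_expMeasure hr (add_pos hτ hν).le]
  simp [correctorNegMean]
  ring

/-! ### One-step means of the corrected maximum -/

/-- The maximum of the coordinates, corrected. -/
noncomputable def correctedMax (μ ν τ : ℝ) (f : Fin 5 → ℝ) (x y : ℝ) : ℝ :=
  max x y + corrector μ ν τ f (y - x)

lemma LinearGrowthTwo.add {g h : ℝ → ℝ → ℝ} (hg : LinearGrowthTwo g) (hh : LinearGrowthTwo h) :
    LinearGrowthTwo fun x y => g x y + h x y := by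
  obtain ⟨hm, C, hC⟩ := hg
  obtain ⟨hm', C', hC'⟩ := hh
  exact ⟨hm.add hm', C + C', fun x y => (abs_add_le _ _).trans (by linarith [hC x y, hC' x y])⟩

lemma linearGrowth_id : LinearGrowth fun x => x :=
  ⟨measurable_id, 1, fun x => by linarith⟩

lemma linearGrowthTwo_sub : LinearGrowthTwo fun x y => y - x := by
  refine ⟨by unfold Function.uncurry; fun_prop, 1, fun x y => ?_⟩
  linarith [abs_sub y x]

lemma linearGrowthTwo_correctedMax {μ ν τ : ℝ} (hμ : 0 < μ) (hν : 0 < ν) (hτ : 0 < τ)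
    (f : Fin 5 → ℝ) :
    LinearGrowthTwo (correctedMax μ ν τ f) :=
  linearGrowth_id.comp_max.add ((linearGrowth_corrector hμ hν hτ f).comp₂ linearGrowthTwo_sub)

lemma integral_correctedMax_zero {μ ν τ : ℝ} (hμ : 0 < μ) (hν : 0 < ν) (hτ : 0 < τ)
    (f : Fin 5 → ℝ) {r : ℝ} (hr : 0 < r) :
    ∫ x, correctedMax μ ν τ f x 0 ∂expMeasure r = meanAtZero ν τ f r := by
  have h : ∀ᵐ x ∂expMeasure r, correctedMax μ ν τ f x 0 = x + corrector μ ν τ f (-x) := by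
    filter_upwards [expMeasure_ae_pos hr] with x hx
    rw [correctedMax, max_eq_left hx.le, zero_sub]
  have hneg : LinearGrowth fun x => corrector μ ν τ f (-x) :=
    (linearGrowth_corrector hμ hν hτ f).comp (h := fun x => -x)
      ⟨measurable_neg, 1, fun x => by simp⟩
  rw [integral_congr_ae h, integral_add (linearGrowth_id.integrable hr) (hneg.integrable hr),
    integral_id_expMeasure hr, integral_corrector_neg hν hτ hr, meanAtZero]

lemma integral_correctedMax_exp {μ ν τ : ℝ} (hμ : 0 < μ) (hν : 0 < ν) (hτ : 0 < τ)
    (f : Fin 5 → ℝ) {r : ℝ} (hr : 0 < r) :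
    ∫ x, ∫ y, correctedMax μ ν τ f x y ∂expMeasure τ ∂expMeasure r = meanAtExp μ ν τ f r := by
  have hc := (linearGrowth_corrector hμ hν hτ f)
  have hm := linearGrowth_id.comp_max
  have hs := hc.comp₂ linearGrowthTwo_sub
  have h : ∀ x, ∫ y, correctedMax μ ν τ f x y ∂expMeasure τ =
      ∫ y, max x y ∂expMeasure τ + ∫ y, corrector μ ν τ f (y - x) ∂expMeasure τ := fun x =>
    integral_add ((hm.right x).integrable hτ) ((hs.right x).integrable hτ)
  simp_rw [h]
  rw [integral_add ((hm.integral hτ).integrable hr) ((hs.integral hτ).integrable hr),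
    integral_max_expMeasure hr hτ linearGrowth_id, integral_sub_expMeasure hr hτ hc,
    integral_corrector hμ hτ, integral_corrector_neg hν hτ hr, integral_id_expMeasure hr,
    integral_id_expMeasure hτ, integral_id_expMeasure (add_pos hr hτ), meanAtExp]

lemma integrable_correctedMax_step {μ ν τ : ℝ} (hμ : 0 < μ) (hν : 0 < ν) (hτ : 0 < τ)
    (f : Fin 5 → ℝ) (d : ℝ) :
    Integrable (fun p : (ℝ × ℝ) × ℝ =>
      correctedMax μ ν τ f (max p.1.1 (p.1.2 + d)) (max 0 (p.2 + d)))
      (((expMeasure μ).prod (expMeasure ν)).prod (expMeasure τ)) := by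
  have := isProbabilityMeasure_expMeasure hμ
  have := isProbabilityMeasure_expMeasure hν
  have := isProbabilityMeasure_expMeasure hτ
  obtain ⟨hm, C, hC⟩ := linearGrowthTwo_correctedMax hμ hν hτ f
  have hC0 : 0 ≤ C := by simpa using (abs_nonneg _).trans (hC 0 0)
  have ha := (integrable_pow_expMeasure hμ 1).abs
  have hb := (integrable_pow_expMeasure hν 1).abs
  have hc := (integrable_pow_expMeasure hτ 1).abs
  simp only [pow_one] at ha hb hc
  have hi : Integrable (fun p : (ℝ × ℝ) × ℝ => C * (1 + 2 * |d| + |p.1.1| + |p.1.2| + |p.2|))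
      (((expMeasure μ).prod (expMeasure ν)).prod (expMeasure τ)) :=
    ((((integrable_const _).add ((ha.comp_fst _).comp_fst _)).add
      ((hb.comp_snd _).comp_fst _)).add (hc.comp_snd _)).const_mul C
  have hm' : Measurable fun p : (ℝ × ℝ) × ℝ => (max p.1.1 (p.1.2 + d), max 0 (p.2 + d)) := by
    fun_prop
  refine hi.mono' (hm.comp hm').aestronglyMeasurable (Eventually.of_forall fun p => ?_)
  refine (hC _ _).trans ?_
  have h1 : |max p.1.1 (p.1.2 + d)| ≤ |p.1.1| + (|p.1.2| + |d|) := by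
    rcases max_choice p.1.1 (p.1.2 + d) with h | h <;> rw [h] <;>
      linarith [abs_add_le p.1.2 d, abs_nonneg p.1.1, abs_nonneg p.1.2, abs_nonneg d]
  have h2 : |max 0 (p.2 + d)| ≤ |p.2| + |d| := by
    rcases max_choice 0 (p.2 + d) with h | h <;> rw [h]
    · rw [abs_zero]; positivity
    · exact abs_add_le p.2 d
  exact mul_le_mul_of_nonneg_left (by linarith) hC0

/-- The mean of the corrected maximum after one step from the state with difference `d`. -/
lemma integral_correctedMax_step {μ ν τ : ℝ} (hμ : 0 < μ) (hν : 0 < ν) (hτ : 0 < τ)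
    (f : Fin 5 → ℝ)
    {L : ℝ} (hf : IsPoissonSolution μ ν τ f L) (d : ℝ) :
    ∫ p : (ℝ × ℝ) × ℝ, correctedMax μ ν τ f (max p.1.1 (p.1.2 + d)) (max 0 (p.2 + d))
      ∂(((expMeasure μ).prod (expMeasure ν)).prod (expMeasure τ)) =
      max 0 d + corrector μ ν τ f d + L := by
  have := isProbabilityMeasure_expMeasure hμ
  have := isProbabilityMeasure_expMeasure hν
  have := isProbabilityMeasure_expMeasure hτ
  have hi := integrable_correctedMax_step hμ hν hτ f d
  have hW := linearGrowthTwo_correctedMax hμ hν hτ f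
  have hV := hW.integral hτ
  obtain ⟨e0, e1, e2, e3, e4⟩ := hf
  rcases lt_or_ge d 0 with hd | hd
  · have he : 0 ≤ -d := by linarith
    -- `K x` is the mean over `c` when the first coordinate is `x`: the second is zero with
    -- probability `1 - exp (τ * d)`, and a fresh exponential of rate `τ` otherwise.
    set K : ℝ → ℝ := fun x => (1 - Real.exp (τ * d)) * correctedMax μ ν τ f x 0 +
      Real.exp (τ * d) * ∫ y, correctedMax μ ν τ f x y ∂expMeasure τ with hK
    have hKg : LinearGrowth K := ((hW.left 0).const_mul _).add (hV.const_mul _)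
    have hKi : ∀ {r : ℝ}, 0 < r → ∫ x, K x ∂expMeasure r =
        (1 - Real.exp (τ * d)) * meanAtZero ν τ f r + Real.exp (τ * d) * meanAtExp μ ν τ f r := by
      intro r hr
      rw [integral_add (((hW.left 0).const_mul _).integrable hr) ((hV.const_mul _).integrable hr),
        integral_const_mul, integral_const_mul, integral_correctedMax_zero hμ hν hτ f hr,
        integral_correctedMax_exp hμ hν hτ f hr]
    have hin : ∀ q : ℝ × ℝ, ∫ c, correctedMax μ ν τ f (max q.1 (q.2 + d)) (max 0 (c + d))
        ∂expMeasure τ = K (max q.1 (q.2 + d)) := fun q => by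
      have := integral_overshoot hτ he (hW.right (max q.1 (q.2 + d)))
      simp only [sub_neg_eq_add, mul_neg, neg_neg] at this
      simp_rw [max_comm (0 : ℝ), this, hK]
    have hKi2 : Integrable (fun q : ℝ × ℝ => K (max q.1 (q.2 + d)))
        ((expMeasure μ).prod (expMeasure ν)) := by
      have := hi.integral_prod_left
      simpa only [hin] using this
    rw [integral_prod _ hi]
    simp_rw [hin]
    rw [integral_prod _ hKi2]
    -- Since `a > 0`, replacing `b + d` by its positive part does not change the maximum, and the
    -- overshoot of `b` above `-d` appears.
    have hae : ∀ᵐ a ∂expMeasure μ, ∫ b, K (max a (b + d)) ∂expMeasure ν =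
        ∫ b, K (max a (max (b - -d) 0)) ∂expMeasure ν := by
      filter_upwards [expMeasure_ae_pos hμ] with a ha
      congr 1
      ext b
      rw [sub_neg_eq_add, max_comm (b + d) 0, ← max_assoc, max_eq_left ha.le]
    rw [integral_congr_ae hae, integral_max_overshoot hμ hν he hKg, hKi hμ, hKi hν,
      hKi (add_pos hμ hν), max_eq_left hd.le, corrector, if_pos hd]
    simp only [mul_neg, neg_neg]
    generalize Real.exp (τ * d) = s
    generalize Real.exp (ν * d) = t
    -- The equations of the linear system are averaged with the mixture weights of the corrector at
    -- `d`.
    linear_combination (-(1 - s) * (1 - t)) * e0 - (1 - s) * t * e1 - s * (1 - t) * e2 - s * t * e3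
  · set V : ℝ → ℝ := fun x => ∫ y, correctedMax μ ν τ f x y ∂expMeasure τ with hVdef
    have hVi : ∀ {r : ℝ}, 0 < r → ∫ x, V x ∂expMeasure r = meanAtExp μ ν τ f r := fun hr =>
      integral_correctedMax_exp hμ hν hτ f hr
    -- As `c + d > 0`, both coordinates can be shifted by `d`; the corrector sees only their
    -- difference, so the shift just adds `d`.
    have hin : ∀ q : ℝ × ℝ, ∫ c, correctedMax μ ν τ f (max q.1 (q.2 + d)) (max 0 (c + d))
        ∂expMeasure τ = d + V (max (q.1 - d) q.2) := fun q => by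
      have h : ∀ᵐ c ∂expMeasure τ,
          correctedMax μ ν τ f (max q.1 (q.2 + d)) (max 0 (c + d)) =
            d + correctedMax μ ν τ f (max (q.1 - d) q.2) c := by
        filter_upwards [expMeasure_ae_pos hτ] with c hc
        have h1 : max q.1 (q.2 + d) = max (q.1 - d) q.2 + d := by
          rw [← max_add_add_right, sub_add_cancel]
        rw [max_eq_right (by linarith : 0 ≤ c + d), h1, correctedMax, correctedMax, max_add_add_right,
          add_sub_add_right_eq_sub]
        ring
      rw [integral_congr_ae h, integral_add (integrable_const _) ((hW.right _).integrable hτ)]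
      simp [hVdef]
    have hVi2 : Integrable (fun q : ℝ × ℝ => d + V (max (q.1 - d) q.2))
        ((expMeasure μ).prod (expMeasure ν)) := by
      have := hi.integral_prod_left
      simpa only [hin] using this
    have hVi3 : Integrable (fun q : ℝ × ℝ => V (max (q.1 - d) q.2))
        ((expMeasure μ).prod (expMeasure ν)) := by
      refine (hVi2.sub (integrable_const d)).congr (Eventually.of_forall fun q => ?_)
      simp
    rw [integral_prod _ hi]
    simp_rw [hin]
    -- The roles are exchanged: now `a` overshoots the level `d`, so `a` is integrated before `b`.
    rw [integral_add (integrable_const _) hVi3, integral_prod_symm _ hVi3]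
    have hae : ∀ᵐ b ∂expMeasure ν, ∫ a, V (max (a - d) b) ∂expMeasure μ =
        ∫ a, V (max b (max (a - d) 0)) ∂expMeasure μ := by
      filter_upwards [expMeasure_ae_pos hν] with b hb
      congr 1
      ext a
      rw [max_comm (a - d) 0, ← max_assoc, max_eq_left hb.le, max_comm]
    rw [integral_congr_ae hae, integral_max_overshoot hν hμ hd hV, hVi hμ, hVi hν,
      hVi (add_pos hν hμ), max_eq_right hd, corrector, if_neg hd.not_gt, add_comm ν μ]
    simp only [integral_const, probReal_univ, one_smul]
    linear_combination (-(1 - Real.exp (-(μ * d)))) * e4 - Real.exp (-(μ * d)) * e3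

/-! ### Explicit solutions of the Poisson equation -/

/-- Adding a constant to all `f i` preserves the system, so `f 3 = 0` may be imposed; five linear
equations then remain for `f 0`, `f 1`, `f 2`, `f 4` and `L`. Here `f 2 = f 4`, because `(a, c)` and
`(b, c)` have the same law when `ν = μ`. -/
lemma exists_isPoissonSolution_nu_eq {μ τ : ℝ} (hμ : 0 < μ) (hτ : 0 < τ) :
    ∃ f, IsPoissonSolution μ μ τ f (numEqNu μ τ / denEqNu μ τ) := by
  set Q : ℝ := 144 * μ ^ 7 + 524 * μ ^ 6 * τ + 968 * μ ^ 5 * τ ^ 2 + 1200 * μ ^ 4 * τ ^ 3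
      + 910 * μ ^ 3 * τ ^ 4 + 387 * μ ^ 2 * τ ^ 5 + 84 * μ * τ ^ 6 + 7 * τ ^ 7 with hQ
  have hQ0 : Q ≠ 0 := by positivity
  have hL : numEqNu μ τ / denEqNu μ τ = numEqNu μ τ / (2 * μ * τ * Q) := rfl
  refine ⟨![-(144 * μ ^ 8 + 524 * μ ^ 7 * τ + 824 * μ ^ 6 * τ ^ 2 + 856 * μ ^ 5 * τ ^ 3
      + 723 * μ ^ 4 * τ ^ 4 + 455 * μ ^ 3 * τ ^ 5 + 178 * μ ^ 2 * τ ^ 6 + 37 * μ * τ ^ 7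
      + 3 * τ ^ 8) / (μ * τ * Q),
    -(144 * μ ^ 7 + 524 * μ ^ 6 * τ + 716 * μ ^ 5 * τ ^ 2 + 535 * μ ^ 4 * τ ^ 3
      + 249 * μ ^ 3 * τ ^ 4 + 74 * μ ^ 2 * τ ^ 5 + 13 * μ * τ ^ 6 + τ ^ 7) / (τ * Q),
    -(τ ^ 2 * (252 * μ ^ 5 + 665 * μ ^ 4 * τ + 661 * μ ^ 3 * τ ^ 2 + 313 * μ ^ 2 * τ ^ 3
      + 71 * μ * τ ^ 4 + 6 * τ ^ 5)) / (2 * μ * Q), 0,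
    -(τ ^ 2 * (252 * μ ^ 5 + 665 * μ ^ 4 * τ + 661 * μ ^ 3 * τ ^ 2 + 313 * μ ^ 2 * τ ^ 3
      + 71 * μ * τ ^ 4 + 6 * τ ^ 5)) / (2 * μ * Q)], ?_⟩
  -- Equal sums of rates are brought to one form, so that the denominators match syntactically.
  have a3 : μ + μ = 2 * μ := by ring
  have a4 : 2 * μ + μ = 3 * μ := by ring
  rw [hL]
  simp only [IsPoissonSolution, meanAtZero, meanAtExp, correctorNegMean, numEqNu, a3, a4,
    add_comm τ μ, Matrix.cons_val]
  -- `Q` stays an opaque nonzero factor while denominators are cleared; expanding it leaves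
  -- polynomial identities.
  refine ⟨?_, ?_, ?_, ?_, ?_⟩ <;> (field_simp; rw [hQ]; ring)

/-- The same linear system at `τ = μ`, again normalised by `f 3 = 0`. -/
lemma exists_isPoissonSolution_tau_eq {μ ν : ℝ} (hμ : 0 < μ) (hν : 0 < ν) :
    ∃ f, IsPoissonSolution μ ν μ f (numEqTau μ ν / denEqTau μ ν) := by
  set Q : ℝ := 192 * μ ^ 8 + 1344 * μ ^ 7 * ν + 4047 * μ ^ 6 * ν ^ 2 + 6770 * μ ^ 5 * ν ^ 3
      + 6799 * μ ^ 4 * ν ^ 4 + 4216 * μ ^ 3 * ν ^ 5 + 1600 * μ ^ 2 * ν ^ 6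
      + 344 * μ * ν ^ 7 + 32 * ν ^ 8 with hQ
  have hQ0 : Q ≠ 0 := by positivity
  have hL : numEqTau μ ν / denEqTau μ ν = numEqTau μ ν / (2 * μ * ν * (μ + ν) * Q) := rfl
  refine ⟨![-(128 * μ ^ 10 + 1024 * μ ^ 9 * ν + 3618 * μ ^ 8 * ν ^ 2 + 7615 * μ ^ 7 * ν ^ 3
      + 10665 * μ ^ 6 * ν ^ 4 + 10327 * μ ^ 5 * ν ^ 5 + 7009 * μ ^ 4 * ν ^ 6
      + 3302 * μ ^ 3 * ν ^ 7 + 1032 * μ ^ 2 * ν ^ 8 + 192 * μ * ν ^ 9 + 16 * ν ^ 10) / (μ * ν * (μ + ν) * Q),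
    -(64 * μ ^ 9 + 656 * μ ^ 8 * ν + 2704 * μ ^ 7 * ν ^ 2 + 5860 * μ ^ 6 * ν ^ 3
      + 7468 * μ ^ 5 * ν ^ 4 + 5992 * μ ^ 4 * ν ^ 5 + 3104 * μ ^ 3 * ν ^ 6
      + 1016 * μ ^ 2 * ν ^ 7 + 192 * μ * ν ^ 8 + 16 * ν ^ 9) / (μ * (μ + ν) * Q),
    -(μ * (128 * μ ^ 8 + 848 * μ ^ 7 * ν + 2292 * μ ^ 6 * ν ^ 2 + 3354 * μ ^ 5 * ν ^ 3
      + 2958 * μ ^ 4 * ν ^ 4 + 1602 * μ ^ 3 * ν ^ 5 + 522 * μ ^ 2 * ν ^ 6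
      + 96 * μ * ν ^ 7 + 8 * ν ^ 8)) / (ν * (μ + ν) * Q), 0,
    -(32 * μ ^ 7 * ν + 363 * μ ^ 6 * ν ^ 2 + 1240 * μ ^ 5 * ν ^ 3
      + 1903 * μ ^ 4 * ν ^ 4 + 1518 * μ ^ 3 * ν ^ 5 + 672 * μ ^ 2 * ν ^ 6
      + 160 * μ * ν ^ 7 + 16 * ν ^ 8) / (μ * Q)], ?_⟩
  have a1 : ν + ν = 2 * ν := by ring
  have a2 : μ + μ = 2 * μ := by ring
  have a3 : μ + (μ + ν) = 2 * μ + ν := by ring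
  have a4 : ν + (μ + ν) = μ + 2 * ν := by ring
  have a5 : μ + ν + μ = 2 * μ + ν := by ring
  have a6 : μ + ν + ν = μ + 2 * ν := by ring
  have a7 : μ + ν + (μ + ν) = 2 * (μ + ν) := by ring
  rw [hL]
  simp only [IsPoissonSolution, meanAtZero, meanAtExp, correctorNegMean, numEqTau, a1, a2, a3, a4,
    a5, a6, a7, add_comm ν μ, Matrix.cons_val]
  refine ⟨?_, ?_, ?_, ?_, ?_⟩ <;> (field_simp; rw [hQ]; ring)

/-! ### A strong law along squares for orthogonal variables -/

lemma integral_sq_sum_le_of_orthogonal {Ω : Type*} [MeasurableSpace Ω] {Pr : Measure Ω}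
    {ξ : ℕ → Ω → ℝ} (hL : ∀ k, MemLp (ξ k) 2 Pr) {C : ℝ}
    (hC : ∀ k, ∫ ω, ξ k ω ^ 2 ∂Pr ≤ C) (ho : ∀ j k, j < k → ∫ ω, ξ j ω * ξ k ω ∂Pr = 0) (n : ℕ) :
    ∫ ω, (∑ i ∈ Finset.range n, ξ i ω) ^ 2 ∂Pr ≤ C * n := by
  have hS : ∀ n, MemLp (fun ω => ∑ i ∈ Finset.range n, ξ i ω) 2 Pr := fun n =>
    memLp_finsetSum _ fun i _ => hL i
  induction n with
  | zero => simp
  | succ n ih =>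
    have hcross : ∫ ω, (∑ i ∈ Finset.range n, ξ i ω) * ξ n ω ∂Pr = 0 := by
      simp_rw [Finset.sum_mul]
      rw [integral_finsetSum _ fun i _ => by exact (hL i).integrable_mul (hL n)]
      exact Finset.sum_eq_zero fun i hi => ho i n (Finset.mem_range.1 hi)
    have h : ∀ ω, (∑ i ∈ Finset.range (n + 1), ξ i ω) ^ 2 = (∑ i ∈ Finset.range n, ξ i ω) ^ 2 +
        2 * ((∑ i ∈ Finset.range n, ξ i ω) * ξ n ω) + ξ n ω ^ 2 := fun ω => by
      rw [Finset.sum_range_succ]; ring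
    simp_rw [h]
    have i1 := (hS n).integrable_sq
    have i2 : Integrable (fun ω => 2 * ((∑ i ∈ Finset.range n, ξ i ω) * ξ n ω)) Pr :=
      ((hS n).integrable_mul (hL n)).const_mul 2
    rw [integral_add (by exact i1.add i2) (hL n).integrable_sq, integral_add i1 i2,
      integral_const_mul, hcross]
    push_cast
    linarith [hC n]

/-- The average of `n ^ 2` orthogonal terms has second moment at most `C / n ^ 2`. This is summable,
so the squared averages are almost surely summable and tend to zero. -/
lemma ae_tendsto_sum_sq_div_of_orthogonal {Ω : Type*} [MeasurableSpace Ω] {Pr : Measure Ω}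
    {ξ : ℕ → Ω → ℝ} (hL : ∀ k, MemLp (ξ k) 2 Pr) (hm : ∀ k, Measurable (ξ k)) {C : ℝ}
    (hC : ∀ k, ∫ ω, ξ k ω ^ 2 ∂Pr ≤ C)
    (ho : ∀ j k, j < k → ∫ ω, ξ j ω * ξ k ω ∂Pr = 0) :
    ∀ᵐ ω ∂Pr, Tendsto (fun n : ℕ => (∑ i ∈ Finset.range (n ^ 2), ξ i ω) / (n : ℝ) ^ 2) atTop
      (𝓝 0) := by
  have hS : ∀ n, MemLp (fun ω => ∑ i ∈ Finset.range n, ξ i ω) 2 Pr := fun n =>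
    memLp_finsetSum _ fun i _ => hL i
  set g : ℕ → Ω → ℝ := fun n ω => ((∑ i ∈ Finset.range (n ^ 2), ξ i ω) / (n : ℝ) ^ 2) ^ 2 with hg
  have hgm : ∀ n, Measurable (g n) := fun n => by
    simp only [hg]
    have := Finset.measurable_sum (Finset.range (n ^ 2)) fun i _ => hm i
    fun_prop
  have hb : ∀ n, ∫⁻ ω, ENNReal.ofReal (g n ω) ∂Pr ≤ ENNReal.ofReal (C * (1 / (n : ℝ) ^ 2)) := by
    intro n
    have hi : Integrable (g n) Pr := by
      simp only [hg, div_pow]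
      exact (hS (n ^ 2)).integrable_sq.div_const _
    rw [← ofReal_integral_eq_lintegral_ofReal hi (Eventually.of_forall fun ω => sq_nonneg _)]
    refine ENNReal.ofReal_le_ofReal ?_
    simp only [hg, div_pow, integral_div]
    have h := integral_sq_sum_le_of_orthogonal hL hC ho (n ^ 2)
    rcases Nat.eq_zero_or_pos n with rfl | hn
    -- At `n = 0` both sides are zero by the convention for division by zero.
    · simp
    · have : (0 : ℝ) < n := by exact_mod_cast hn
      rw [div_le_iff₀ (by positivity)]
      refine h.trans (le_of_eq ?_)
      push_cast
      field_simp
  have hsum : Summable fun n : ℕ => C * (1 / (n : ℝ) ^ 2) :=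
    (Real.summable_one_div_nat_pow.2 one_lt_two).mul_left C
  have hfin : ∫⁻ ω, ∑' n, ENNReal.ofReal (g n ω) ∂Pr ≠ ⊤ := by
    rw [lintegral_tsum fun n => (hgm n).ennreal_ofReal.aemeasurable]
    exact ne_top_of_le_ne_top hsum.tsum_ofReal_ne_top (ENNReal.tsum_le_tsum hb)
  have hae := ae_lt_top (Measurable.tsum fun n => (hgm n).ennreal_ofReal) hfin
  filter_upwards [hae] with ω hω
  have h1 := ENNReal.tendsto_atTop_zero_of_tsum_ne_top hω.ne
  have h2 := (ENNReal.tendsto_toReal ENNReal.zero_ne_top).comp h1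
  have h3 : Tendsto (fun n => g n ω) atTop (𝓝 0) := by
    refine h2.congr fun n => ?_
    simp only [Function.comp]
    exact ENNReal.toReal_ofReal (sq_nonneg _)
  have h4 := h3.sqrt
  simp only [hg, Real.sqrt_sq_eq_abs, Real.sqrt_zero] at h4
  exact (tendsto_zero_iff_abs_tendsto_zero _).2 h4

/-! ### The max-plus process -/

/-- With `(X, D)` fixed, independence lets `U` be integrated first, and that integral vanishes. This
replaces conditional expectation in the orthogonality of martingale differences. -/
lemma integral_mul_comp_eq_zero_of_indepFun {Ω E : Type*} [MeasurableSpace Ω] [MeasurableSpace E]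
    {Pr : Measure Ω} [IsProbabilityMeasure Pr] {X D : Ω → ℝ} {U : Ω → E}
    (hX : Measurable X) (hD : Measurable D) (hU : Measurable U)
    (hind : IndepFun (fun ω => (X ω, D ω)) U Pr) {Ψ : ℝ → E → ℝ}
    (hΨ : Measurable (Function.uncurry Ψ)) (h0 : ∀ d, ∫ u, Ψ d u ∂Pr.map U = 0)
    (hi : Integrable (fun ω => X ω * Ψ (D ω) (U ω)) Pr) :
    ∫ ω, X ω * Ψ (D ω) (U ω) ∂Pr = 0 := by
  have hV : Measurable fun ω => (X ω, D ω) := hX.prodMk hD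
  have hVU : Measurable fun ω => ((X ω, D ω), U ω) := hV.prodMk hU
  have hmap := (indepFun_iff_map_prod_eq_prod_map_map hV.aemeasurable hU.aemeasurable).1 hind
  have := Measure.isProbabilityMeasure_map (μ := Pr) hU.aemeasurable
  have := Measure.isProbabilityMeasure_map (μ := Pr) hV.aemeasurable
  set G : (ℝ × ℝ) × E → ℝ := fun p => p.1.1 * Ψ p.1.2 p.2 with hG
  have hGm : Measurable G := by
    have h : Measurable fun p : (ℝ × ℝ) × E => (p.1.2, p.2) := by fun_prop
    exact (measurable_fst.comp measurable_fst).mul (hΨ.comp h)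
  have hi' : Integrable G (Pr.map fun ω => ((X ω, D ω), U ω)) :=
    (integrable_map_measure hGm.aestronglyMeasurable hVU.aemeasurable).2 hi
  have he : ∫ ω, X ω * Ψ (D ω) (U ω) ∂Pr = ∫ p, G p ∂Pr.map fun ω => ((X ω, D ω), U ω) :=
    (integral_map hVU.aemeasurable hGm.aestronglyMeasurable).symm
  rw [hmap] at hi' he
  rw [he, integral_prod _ hi']
  simp [hG, integral_const_mul, h0]

/-- The increment of the corrected maximum, recentred at `L`, in one step from the state with
difference `d` under the noise `p`. -/
noncomputable def stepIncrement (μ ν τ : ℝ) (f : Fin 5 → ℝ) (L d : ℝ) (p : (ℝ × ℝ) × ℝ) : ℝ :=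
  correctedMax μ ν τ f (max p.1.1 (p.1.2 + d)) (max 0 (p.2 + d)) -
    (max 0 d + corrector μ ν τ f d + L)

lemma measurable_stepIncrement (μ ν τ : ℝ) (f : Fin 5 → ℝ) (L : ℝ) :
    Measurable (Function.uncurry (stepIncrement μ ν τ f L)) := by
  unfold Function.uncurry stepIncrement correctedMax
  have := measurable_corrector μ ν τ f
  fun_prop

/-- One step moves the maximum from `max 0 d` by at most `|a| + |b| + |c|`, whatever `d` is, and the
corrector is bounded. Hence the second moments are bounded uniformly in time. -/
lemma stepIncrement_sq_le {μ ν τ : ℝ} (hμ : 0 < μ) (hν : 0 < ν) (hτ : 0 < τ) (f : Fin 5 → ℝ)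
    (L : ℝ) : ∃ K, ∀ d p,
      stepIncrement μ ν τ f L d p ^ 2 ≤ 4 * (p.1.1 ^ 2 + p.1.2 ^ 2 + p.2 ^ 2 + K ^ 2) := by
  set B := |f 0| + |f 1| + |f 2| + |f 3| + |f 4|
  have hB := abs_corrector_le hμ hν hτ f
  refine ⟨2 * B + |L|, ?_⟩
  rintro d ⟨⟨a, b⟩, c⟩
  simp only
  have h : |stepIncrement μ ν τ f L d ((a, b), c)| ≤ |a| + |b| + |c| + (2 * B + |L|) := by
    have h1 := abs_le.1 (hB d)
    have h2 := abs_le.1 (hB (max 0 (c + d) - max a (b + d)))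
    have h3 := abs_le.1 (le_refl |L|)
    have e1 : max (max a (b + d)) (max 0 (c + d)) ≤ max 0 d + (|a| + |b| + |c|) := by
      have := le_max_left 0 d
      have := le_max_right 0 d
      refine max_le (max_le ?_ ?_) (max_le ?_ ?_) <;>
        linarith [abs_nonneg a, abs_nonneg b, abs_nonneg c, le_abs_self a, le_abs_self b,
          le_abs_self c]
    have e2 : max 0 d - |c| ≤ max (max a (b + d)) (max 0 (c + d)) := by
      refine le_trans ?_ (le_max_right _ _)
      rw [sub_le_iff_le_add]
      have := le_max_left 0 (c + d)
      have := le_max_right 0 (c + d)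
      refine max_le ?_ ?_ <;> linarith [abs_nonneg c, neg_abs_le c]
    simp only [stepIncrement, correctedMax]
    rw [abs_le]
    constructor <;> linarith [abs_nonneg a, abs_nonneg b, abs_nonneg c]
  have h' := sq_le_sq' (by linarith [(abs_le.1 h).1]) (abs_le.1 h).2
  refine h'.trans ?_
  rw [← sq_abs a, ← sq_abs b, ← sq_abs c]
  generalize |a| = x
  generalize |b| = y
  generalize |c| = z
  generalize 2 * B + |L| = w
  -- This is the Cauchy–Schwarz bound `(x + y + z + w) ^ 2 ≤ 4 * (x ^ 2 + y ^ 2 + z ^ 2 + w ^ 2)`.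
  nlinarith [sq_nonneg (x - y), sq_nonneg (x - z), sq_nonneg (x - w), sq_nonneg (y - z),
    sq_nonneg (y - w), sq_nonneg (z - w)]

lemma integral_stepIncrement {μ ν τ : ℝ} (hμ : 0 < μ) (hν : 0 < ν) (hτ : 0 < τ) (f : Fin 5 → ℝ)
    {L : ℝ} (hf : IsPoissonSolution μ ν τ f L) (d : ℝ) :
    ∫ p, stepIncrement μ ν τ f L d p
      ∂(((expMeasure μ).prod (expMeasure ν)).prod (expMeasure τ)) = 0 := by
  have := isProbabilityMeasure_expMeasure hμ
  have := isProbabilityMeasure_expMeasure hν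
  have := isProbabilityMeasure_expMeasure hτ
  unfold stepIncrement
  rw [integral_sub (integrable_correctedMax_step hμ hν hτ f d) (integrable_const _),
    integral_correctedMax_step hμ hν hτ f hf d]
  simp

lemma maxPlusState_succ (a b c : ℕ → ℝ) (k : ℕ) :
    maxPlusState (fun j => !![a j, b j; 0, c j]) (k + 1) =
      ![max (maxPlusState (fun j => !![a j, b j; 0, c j]) k 0 + a k)
          (maxPlusState (fun j => !![a j, b j; 0, c j]) k 1 + b k),
        max (maxPlusState (fun j => !![a j, b j; 0, c j]) k 0)
          (maxPlusState (fun j => !![a j, b j; 0, c j]) k 1 + c k)] := by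
  ext i
  fin_cases i <;> simp [maxPlusState]

/-- The recursion commutes with adding a constant to both coordinates, so the increment depends on
the state only through its difference. -/
lemma correctedMax_maxPlusState_succ (μ ν τ : ℝ) (f : Fin 5 → ℝ) (L : ℝ) (a b c : ℕ → ℝ) (k : ℕ) :
    let z := maxPlusState (fun j => !![a j, b j; 0, c j])
    stepIncrement μ ν τ f L (z k 1 - z k 0) ((a k, b k), c k) =
      correctedMax μ ν τ f (z (k + 1) 0) (z (k + 1) 1) - correctedMax μ ν τ f (z k 0) (z k 1)
        - L := by
  intro z
  have hz : z (k + 1) = ![max (z k 0 + a k) (z k 1 + b k), max (z k 0) (z k 1 + c k)] :=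
    maxPlusState_succ a b c k
  rw [hz]
  simp only [Matrix.cons_val]
  generalize z k 0 = x
  generalize z k 1 = y
  have h1 : max (x + a k) (y + b k) = x + max (a k) (b k + (y - x)) := by
    rw [← max_add_add_left]; congr 1; ring
  have h2 : max x (y + c k) = x + max 0 (c k + (y - x)) := by
    rw [← max_add_add_left]; congr 1 <;> ring
  have h3 : max x y = x + max 0 (y - x) := by
    rw [← max_add_add_left]; congr 1 <;> ring
  rw [h1, h2, stepIncrement, correctedMax, correctedMax, correctedMax, max_add_add_left, h3,
    add_sub_add_left_eq_sub]
  ring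

lemma sum_stepIncrement (μ ν τ : ℝ) (f : Fin 5 → ℝ) (L : ℝ) (a b c : ℕ → ℝ) (n : ℕ) :
    let z := maxPlusState (fun j => !![a j, b j; 0, c j])
    ∑ k ∈ Finset.range n, stepIncrement μ ν τ f L (z k 1 - z k 0) ((a k, b k), c k) =
      max (z n 0) (z n 1) + corrector μ ν τ f (z n 1 - z n 0) - corrector μ ν τ f 0 - n * L := by
  intro z
  induction n with
  | zero => simp [z, maxPlusState]
  | succ n ih =>
    rw [Finset.sum_range_succ, ih, correctedMax_maxPlusState_succ μ ν τ f L a b c n]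
    simp only [correctedMax, z]
    push_cast
    ring

lemma monotone_max_maxPlusState {a b c : ℕ → ℝ} (ha : ∀ k, 0 ≤ a k) (hc : ∀ k, 0 ≤ c k) :
    Monotone fun n => max (maxPlusState (fun j => !![a j, b j; 0, c j]) n 0)
      (maxPlusState (fun j => !![a j, b j; 0, c j]) n 1) := by
  refine monotone_nat_of_le_succ fun n => ?_
  rw [maxPlusState_succ]
  simp only [Matrix.cons_val]
  exact max_le_max ((le_add_of_nonneg_right (ha n)).trans (le_max_left _ _))
    ((le_add_of_nonneg_right (hc n)).trans (le_max_right _ _))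

/-! ### Past noise and its independence of the current step -/

/-- The information carried by the noise before step `k`. -/
abbrev pastSpace {Ω : Type*} (X : Fin 3 × ℕ → Ω → ℝ) (k : ℕ) : MeasurableSpace Ω :=
  ⨆ p ∈ {p : Fin 3 × ℕ | p.2 < k}, MeasurableSpace.comap (X p) inferInstance

lemma pastSpace_mono {Ω : Type*} (X : Fin 3 × ℕ → Ω → ℝ) : Monotone (pastSpace X) :=
  fun _ _ h => biSup_mono fun _ hp => lt_of_lt_of_le hp h

lemma measurable_pastSpace {Ω : Type*} (X : Fin 3 × ℕ → Ω → ℝ) {k j : ℕ} (h : j < k) (i : Fin 3) :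
    Measurable[pastSpace X k] (X (i, j)) := by
  refine (comap_measurable (X (i, j))).mono ?_ le_rfl
  exact le_iSup₂ (f := fun p (_ : p ∈ {p : Fin 3 × ℕ | p.2 < k}) =>
    MeasurableSpace.comap (X p) inferInstance) (i, j) h

lemma measurable_maxPlusState_pastSpace {Ω : Type*} (X : Fin 3 × ℕ → Ω → ℝ) (k : ℕ) (i : Fin 2) :
    Measurable[pastSpace X k] fun ω =>
      maxPlusState (fun j => !![X (0, j) ω, X (1, j) ω; 0, X (2, j) ω]) k i := by
  induction k generalizing i with
  | zero => exact measurable_const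
  | succ k ih =>
    have h0 := (ih 0).mono (pastSpace_mono X k.le_succ) le_rfl
    have h1 := (ih 1).mono (pastSpace_mono X k.le_succ) le_rfl
    have hX := fun i => measurable_pastSpace X k.lt_succ_self i
    simp_rw [maxPlusState_succ]
    fin_cases i
    · exact (h0.add (hX 0)).max (h1.add (hX 1))
    · exact h0.max (h1.add (hX 2))

lemma indepFun_pastSpace {Ω : Type*} [MeasurableSpace Ω] {Pr : Measure Ω}
    {X : Fin 3 × ℕ → Ω → ℝ} (hm : ∀ p, Measurable (X p)) (hX : iIndepFun X Pr) (k : ℕ)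
    {E : Type*} [MeasurableSpace E] {V : Ω → E} (hV : Measurable[pastSpace X k] V) :
    IndepFun V (fun ω => ((X (0, k) ω, X (1, k) ω), X (2, k) ω)) Pr := by
  have hST : Disjoint {p : Fin 3 × ℕ | p.2 < k} {p : Fin 3 × ℕ | p.2 = k} :=
    Set.disjoint_left.2 fun p (h1 : p.2 < k) (h2 : p.2 = k) => absurd h2 h1.ne
  have h := indep_iSup_of_disjoint (fun p => (hm p).comap_le) hX.iIndep hST
  have hU : ∀ i : Fin 3, Measurable[⨆ p ∈ {p : Fin 3 × ℕ | p.2 = k},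
      MeasurableSpace.comap (X p) inferInstance] (X (i, k)) := fun i => by
    refine (comap_measurable (X (i, k))).mono ?_ le_rfl
    exact le_iSup₂ (f := fun p (_ : p ∈ {p : Fin 3 × ℕ | p.2 = k}) =>
      MeasurableSpace.comap (X p) inferInstance) (i, k) rfl
  rw [IndepFun_iff_Indep]
  exact indep_of_indep_of_le_left (indep_of_indep_of_le_right h
    (((hU 0).prodMk (hU 1)).prodMk (hU 2)).comap_le) hV.comap_le

lemma map_noise {Ω : Type*} [MeasurableSpace Ω] {Pr : Measure Ω} [IsProbabilityMeasure Pr]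
    {X : Fin 3 × ℕ → Ω → ℝ} (hm : ∀ p, Measurable (X p)) (hX : iIndepFun X Pr) (k : ℕ) :
    Pr.map (fun ω => ((X (0, k) ω, X (1, k) ω), X (2, k) ω)) =
      ((Pr.map (X (0, k))).prod (Pr.map (X (1, k)))).prod (Pr.map (X (2, k))) := by
  have h1 := hX.indepFun_prodMk hm (0, k) (1, k) (2, k) (by simp) (by simp)
  have h2 : IndepFun (X (0, k)) (X (1, k)) Pr := hX.indepFun (by simp)
  rw [(indepFun_iff_map_prod_eq_prod_map_map ((hm _).prodMk (hm _)).aemeasurable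
    (hm _).aemeasurable).1 h1, (indepFun_iff_map_prod_eq_prod_map_map (hm _).aemeasurable
    (hm _).aemeasurable).1 h2]

/-! ### From squares to all times, and the Lyapunov exponent -/

lemma tendsto_div_of_monotone_of_tendsto_sq {u : ℕ → ℝ} {l : ℝ} (hmono : Monotone u)
    (h : Tendsto (fun n : ℕ => u (n ^ 2) / (n : ℝ) ^ 2) atTop (𝓝 l)) :
    Tendsto (fun n => u n / n) atTop (𝓝 l) := by
  refine tendsto_div_of_monotone_of_exists_subseq_tendsto_div u l hmono fun a ha =>
    -- Interpolation works because consecutive squares have ratio `(1 + 1 / n) ^ 2`, eventually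
    -- below any `a > 1`.
    ⟨fun n => n ^ 2, ?_, tendsto_pow_atTop two_ne_zero, by simpa using h⟩
  have h1 : Tendsto (fun n : ℕ => (1 + 1 / (n : ℝ)) ^ 2) atTop (𝓝 1) := by
    have := (tendsto_one_div_atTop_nhds_zero_nat (𝕜 := ℝ)).const_add 1
    simpa using this.pow 2
  filter_upwards [h1.eventually (gt_mem_nhds ha), eventually_gt_atTop 0] with n hn hn0
  have hn0' : (0 : ℝ) < n := by exact_mod_cast hn0
  have e : ((n : ℝ) + 1) ^ 2 = (1 + 1 / (n : ℝ)) ^ 2 * (n : ℝ) ^ 2 := by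
    field_simp
  push_cast
  rw [e]
  gcongr

theorem isLyapunovExponent_of_isPoissonSolution {Ω : Type*} [MeasurableSpace Ω] (Pr : Measure Ω)
    [IsProbabilityMeasure Pr] {μ ν τ : ℝ} (hμ : 0 < μ) (hν : 0 < ν) (hτ : 0 < τ)
    {X : Fin 3 × ℕ → Ω → ℝ} (hm : ∀ p, Measurable (X p))
    (hα : ∀ k, Pr.map (X (0, k)) = expMeasure μ) (hβ : ∀ k, Pr.map (X (1, k)) = expMeasure ν)
    (hδ : ∀ k, Pr.map (X (2, k)) = expMeasure τ) (hX : iIndepFun X Pr) {f : Fin 5 → ℝ} {L : ℝ}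
    (hf : IsPoissonSolution μ ν τ f L) :
    IsLyapunovExponent Pr (fun k ω => !![X (0, k) ω, X (1, k) ω; 0, X (2, k) ω]) L := by
  set z : ℕ → Ω → Fin 2 → ℝ := fun k ω =>
    maxPlusState (fun j => !![X (0, j) ω, X (1, j) ω; 0, X (2, j) ω]) k with hz
  set D : ℕ → Ω → ℝ := fun k ω => z k ω 1 - z k ω 0 with hD
  set U : ℕ → Ω → (ℝ × ℝ) × ℝ := fun k ω => ((X (0, k) ω, X (1, k) ω), X (2, k) ω) with hU
  set ξ : ℕ → Ω → ℝ := fun k ω => stepIncrement μ ν τ f L (D k ω) (U k ω) with hξ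
  have hle : ∀ k, pastSpace X k ≤ ‹MeasurableSpace Ω› := fun k =>
    iSup₂_le fun p _ => (hm p).comap_le
  have hDm' : ∀ k, Measurable[pastSpace X k] (D k) := fun k =>
    (measurable_maxPlusState_pastSpace X k 1).sub (measurable_maxPlusState_pastSpace X k 0)
  have hDm : ∀ k, Measurable (D k) := fun k => (hDm' k).mono (hle k) le_rfl
  have hUm : ∀ k, Measurable (U k) := fun k => ((hm _).prodMk (hm _)).prodMk (hm _)
  have hΨ := measurable_stepIncrement μ ν τ f L
  have hξm : ∀ k, Measurable (ξ k) := fun k => hΨ.comp ((hDm k).prodMk (hUm k))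
  have hξm' : ∀ j k, j < k → Measurable[pastSpace X k] (ξ j) := fun j k hjk =>
    hΨ.comp (((hDm' j).mono (pastSpace_mono X hjk.le) le_rfl).prodMk
      (((measurable_pastSpace X hjk 0).prodMk (measurable_pastSpace X hjk 1)).prodMk
        (measurable_pastSpace X hjk 2)))
  obtain ⟨K, hK⟩ := stepIncrement_sq_le hμ hν hτ f L
  have hsq : ∀ {r : ℝ} (p : Fin 3 × ℕ), 0 < r → Pr.map (X p) = expMeasure r →
      Integrable (fun ω => X p ω ^ 2) Pr ∧
        ∫ ω, X p ω ^ 2 ∂Pr = ∫ x, x ^ 2 ∂expMeasure r := by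
    intro r p hr hp
    have hs : AEStronglyMeasurable (fun x : ℝ => x ^ 2) (Pr.map (X p)) :=
      (measurable_id.pow_const 2).aestronglyMeasurable
    refine ⟨(integrable_map_measure hs (hm p).aemeasurable).1
      (hp ▸ integrable_pow_expMeasure hr 2), ?_⟩
    rw [← hp, integral_map (hm p).aemeasurable hs]
  have hbi : ∀ k, Integrable (fun ω => 4 * (X (0, k) ω ^ 2 + X (1, k) ω ^ 2 + X (2, k) ω ^ 2
      + K ^ 2)) Pr := fun k =>
    ((((hsq _ hμ (hα k)).1.add (hsq _ hν (hβ k)).1).add (hsq _ hτ (hδ k)).1).add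
      (integrable_const _)).const_mul 4
  have hξi : ∀ k, Integrable (fun ω => ξ k ω ^ 2) Pr := fun k =>
    (hbi k).mono' ((hξm k).pow_const 2).aestronglyMeasurable (Eventually.of_forall fun ω => by
      rw [Real.norm_eq_abs, abs_of_nonneg (sq_nonneg _)]
      exact hK _ _)
  have hξL : ∀ k, MemLp (ξ k) 2 Pr := fun k =>
    (memLp_two_iff_integrable_sq (hξm k).aestronglyMeasurable).2 (hξi k)
  have hC : ∀ k, ∫ ω, ξ k ω ^ 2 ∂Pr ≤ 4 * (∫ x, x ^ 2 ∂expMeasure μ + ∫ x, x ^ 2 ∂expMeasure ν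
      + ∫ x, x ^ 2 ∂expMeasure τ + K ^ 2) := by
    intro k
    refine (integral_mono (hξi k) (hbi k) fun ω => hK _ _).trans (le_of_eq ?_)
    have i0 := (hsq _ hμ (hα k)).1
    have i1 := (hsq _ hν (hβ k)).1
    have i2 := (hsq _ hτ (hδ k)).1
    rw [integral_const_mul, integral_add (by exact (i0.add i1).add i2) (integrable_const _),
      integral_add (by exact i0.add i1) i2, integral_add i0 i1, (hsq _ hμ (hα k)).2,
      (hsq _ hν (hβ k)).2, (hsq _ hτ (hδ k)).2]
    simp
  -- For `j < k`, both `ξ j` and `D k` are functions of the noise before step `k`, while `U k` is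
  -- independent of it and `ξ k` has mean zero for every fixed value of `D k`.
  have ho : ∀ j k, j < k → ∫ ω, ξ j ω * ξ k ω ∂Pr = 0 := by
    intro j k hjk
    refine integral_mul_comp_eq_zero_of_indepFun (hξm j) (hDm k) (hUm k)
      (indepFun_pastSpace hm hX k ((hξm' j k hjk).prodMk (hDm' k))) hΨ (fun d => ?_)
      ((hξL j).integrable_mul (hξL k))
    rw [map_noise hm hX k, hα, hβ, hδ]
    exact integral_stepIncrement hμ hν hτ f hf d
  have hpos : ∀ {r : ℝ} (p : Fin 3 × ℕ), 0 < r → Pr.map (X p) = expMeasure r →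
      ∀ᵐ ω ∂Pr, 0 ≤ X p ω := by
    intro r p hr hp
    have h := expMeasure_ae_pos hr
    rw [← hp] at h
    filter_upwards [ae_of_ae_map (hm p).aemeasurable h] with ω hω using hω.le
  filter_upwards [ae_tendsto_sum_sq_div_of_orthogonal hξL hξm hC ho,
    ae_all_iff.2 fun k => hpos _ hμ (hα k), ae_all_iff.2 fun k => hpos _ hτ (hδ k)] with ω hω ha hc
  have hmono := monotone_max_maxPlusState (a := fun j => X (0, j) ω) (b := fun j => X (1, j) ω)
    (c := fun j => X (2, j) ω) ha hc
  have hsum := sum_stepIncrement μ ν τ f L (fun j => X (0, j) ω) (fun j => X (1, j) ω)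
    (fun j => X (2, j) ω)
  have hsq0 : Tendsto (fun n : ℕ => 1 / (n : ℝ) ^ 2) atTop (𝓝 0) := by
    have := (tendsto_one_div_atTop_nhds_zero_nat (𝕜 := ℝ)).pow 2
    simpa using this
  have hcor : Tendsto (fun n : ℕ => (corrector μ ν τ f (D (n ^ 2) ω) - corrector μ ν τ f 0) *
      (1 / (n : ℝ) ^ 2)) atTop (𝓝 0) := by
    refine bdd_le_mul_tendsto_zero' (2 * (|f 0| + |f 1| + |f 2| + |f 3| + |f 4|))
      (Eventually.of_forall fun n => ?_) hsq0
    have h1 := abs_corrector_le hμ hν hτ f (D (n ^ 2) ω)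
    have h2 := abs_corrector_le hμ hν hτ f 0
    exact (abs_sub _ _).trans (by linarith)
  have hlim := (hω.sub hcor).add_const L
  rw [sub_zero, zero_add] at hlim
  have key := tendsto_div_of_monotone_of_tendsto_sq hmono (hlim.congr' ?_)
  · exact key.congr fun n => by rw [div_eq_mul_one_div, mul_comm]
  · filter_upwards [eventually_gt_atTop 0] with n hn
    have hn' : (n : ℝ) ≠ 0 := by exact_mod_cast hn.ne'
    have e : ∑ i ∈ Finset.range (n ^ 2), ξ i ω = _ := hsum (n ^ 2)
    rw [e]
    simp only [hD, hz]
    push_cast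
    field_simp
    ring

theorem mainTheorem7 {Ω : Type*} [MeasurableSpace Ω] (Pr : Measure Ω) [IsProbabilityMeasure Pr]
    (μ ν τ : ℝ) (hμ : 0 < μ) (hν : 0 < ν) (hτ : 0 < τ)
    (α β δ : ℕ → Ω → ℝ)
    (hαm : ∀ k, Measurable (α k)) (hβm : ∀ k, Measurable (β k)) (hδm : ∀ k, Measurable (δ k))
    (hα : ∀ k, Pr.map (α k) = expMeasure μ)
    (hβ : ∀ k, Pr.map (β k) = expMeasure ν)
    (hδ : ∀ k, Pr.map (δ k) = expMeasure τ)
    (hindep : iIndepFun (fun p : Fin 3 × ℕ => ![α, β, δ] p.1 p.2) Pr) :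
    (ν = μ →
      IsLyapunovExponent Pr (fun k ω => !![α k ω, β k ω; 0, δ k ω])
        (numEqNu μ τ / denEqNu μ τ)) ∧
    (τ = μ →
      IsLyapunovExponent Pr (fun k ω => !![α k ω, β k ω; 0, δ k ω])
        (numEqTau μ ν / denEqTau μ ν)) := by
  have hm : ∀ p : Fin 3 × ℕ, Measurable ((fun p : Fin 3 × ℕ => ![α, β, δ] p.1 p.2) p) := by
    rintro ⟨i, k⟩
    fin_cases i
    exacts [hαm k, hβm k, hδm k]
  constructor
  · rintro rfl
    obtain ⟨f, hf⟩ := exists_isPoissonSolution_nu_eq hν hτ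
    exact isLyapunovExponent_of_isPoissonSolution Pr hν hν hτ hm hα hβ hδ hindep hf
  · rintro rfl
    obtain ⟨f, hf⟩ := exists_isPoissonSolution_tau_eq hτ hν
    exact isLyapunovExponent_of_isPoissonSolution Pr hτ hν hτ hm hα hβ hδ hindep hf
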